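/- Let $n\ge 0$, and let $(W,S)$ be a Coxeter system with $S=\{s_1,\dots,s_n\}$ of type $\mathrm{A}_n$ or $\mathrm{B}_n$, with the generators numbered along the Coxeter diagram: $s_is_j$ has order $2$ for $|i-j|\ge 2$ and order $3$ for $|i-j|=1$, except that in type $\mathrm{B}_n$ ($n\ge 2$) the product $s_1s_2$ has order $4$. (For $n=1$ both types are $\langle s_1\mid s_1^2\rangle$; for $n=0$ the group is trivial.) *Deletion order.* For $0\le i\le n$ define a strict total order $<_\Delta^i$ on the words in $s_1,\dots,s_i$ recursively. For $i=0$ there is only the empty word. For $i\ge 1$, cut a word $u$ at the occurrences of $s_i$, $u=b_0s_ib_1s_i\cdots s_ib_k$ with $b_0,\dots,b_k$ (possibly empty) words in $s_1,\dots,s_{i-1}$, and likewise $v=c_0s_ic_1s_i\cdots s_ic_\ell$. Then $u<_\Delta^i v$ if $k<\ell$, or if $k=\ell$, $u\neq v$, and $b_j<_\Delta^{i-1}c_j$ for the least $j$ with $b_j\ne c_j$. Put ${<_\Delta}={<_\Delta^n}$. For $w\in W$ let $\mathrm{NF}_\Delta(w)$ be the $<_\Delta$-least reduced word for $w$, and for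 $u,v\in W$ write $u<_\Delta^W v$ if $\mathrm{NF}_\Delta(u)<_\Delta\mathrm{NF}_\Delta(v)$. Let $L(w)=|\{u\in W : u<_\Delta^W w\}|+1$ be the position of $w$ in this order. Then $W$ is finite, it has a unique element $\omega_0$ of maximal length, and $$L(w)+L(\omega_0w)=|W|+1\qquad\text{for every } w\in W.$$ -/

import Mathlib

namespace DeletionOrder

/-- The Coxeter matrix of type `B_n` whose vertices are numbered so that the double edge
(the label `4`) joins the first two vertices. Mathlib's `CoxeterMatrix.B n` puts the double edge
at the other end of the diagram, so the numbering of the vertices is reversed. -/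
def typeB (n : ℕ) : CoxeterMatrix (Fin n) := (CoxeterMatrix.B n).reindex Fin.revPerm

variable {n : ℕ}

/-- The deletion sequence `[b₀, …, b_ℓ]` of the word `w` with respect to the letter `j`: the word
is cut at every occurrence of `j`, so that `w = b₀ j b₁ j … j b_ℓ` and `j` occurs in no `bᵢ`.
It is `[w]` if `j` does not occur in `w`. -/
def deletionSeq (j : ℕ) (w : List (Fin n)) : List (List (Fin n)) :=
  w.splitOnP fun a => decide ((a : ℕ) = j)

/-- The deletion order on the words in the first `i` letters `0, …, i - 1`. Two such words are
compared through their deletion sequences with respect to the largest letter `i - 1`: the word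
with the shorter deletion sequence is the smaller one; if both sequences have the same length, then
their first distinct entries are compared in the deletion order on words in `i - 1` letters.
On no letters there is only the empty word; on one letter this compares the lengths. -/
def levelLT : ℕ → List (Fin n) → List (Fin n) → Prop
  | 0, _, _ => False
  | i + 1, u, v => List.Shortlex (levelLT i) (deletionSeq i u) (deletionSeq i v)

/-- The deletion order `u <_Δ v` on all words over the alphabet `Fin n`. -/
def wordLT (u v : List (Fin n)) : Prop := levelLT n u v

section Facts

theorem levelLT_wf (i : ℕ) : WellFounded (levelLT (n := n) i) := by
  induction i with
  | zero => exact ⟨fun a => ⟨a, fun _ h => h.elim⟩⟩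
  | succ i ih => exact InvImage.wf (deletionSeq i) (List.Shortlex.wf ih)

theorem deletionSeq_injective (j : ℕ) :
    Function.Injective (deletionSeq (n := n) j) := by
  intro u
  induction u with
  | nil =>
    intro v h
    cases v with
    | nil => rfl
    | cons y v =>
      simp only [deletionSeq, List.splitOnP_nil, List.splitOnP_cons_eq_if_modifyHead] at h
      have h2 := List.splitOnP_ne_nil (fun a : Fin n => decide ((a : ℕ) = j)) v
      cases h3 : List.splitOnP (fun a : Fin n => decide ((a : ℕ) = j)) v with
      | nil => exact absurd h3 h2
      | cons b t => rw [h3] at h; split_ifs at h <;> simp at h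
  | cons x u ih =>
    intro v h
    have hu := List.splitOnP_ne_nil (fun a : Fin n => decide ((a : ℕ) = j)) u
    cases h3 : List.splitOnP (fun a : Fin n => decide ((a : ℕ) = j)) u with
    | nil => exact absurd h3 hu
    | cons b t =>
      cases v with
      | nil =>
        simp only [deletionSeq, List.splitOnP_nil, List.splitOnP_cons_eq_if_modifyHead, h3] at h
        split_ifs at h <;> simp at h
      | cons y v =>
        have hv := List.splitOnP_ne_nil (fun a : Fin n => decide ((a : ℕ) = j)) v
        cases h4 : List.splitOnP (fun a : Fin n => decide ((a : ℕ) = j)) v with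
        | nil => exact absurd h4 hv
        | cons c s =>
          have key : b :: t = c :: s → u = v := fun e => ih (by
            simp only [deletionSeq, h3, h4, e])
          simp only [deletionSeq, List.splitOnP_cons_eq_if_modifyHead, h3, h4] at h
          split_ifs at h with hx hy hy
          · simp only [decide_eq_true_eq] at hx hy
            rw [Fin.ext (hx.trans hy.symm), key (List.cons.inj h).2]
          · simp at h
          · simp at h
          · simp only [List.modifyHead_cons, List.cons.injEq] at h
            rw [h.1.1, key (by rw [h.1.2, h.2])]

theorem mem_deletionSeq (j : ℕ) (w : List (Fin n)) :
    ∀ b ∈ deletionSeq j w, ∀ a ∈ b, a ∈ w ∧ (a : ℕ) ≠ j := by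
  induction w with
  | nil => intro b hb a ha; simp [deletionSeq] at hb; simp [hb] at ha
  | cons x w ih =>
    intro b hb a ha
    have hw := List.splitOnP_ne_nil (fun a : Fin n => decide ((a : ℕ) = j)) w
    simp only [deletionSeq] at ih
    cases h3 : List.splitOnP (fun a : Fin n => decide ((a : ℕ) = j)) w with
    | nil => exact absurd h3 hw
    | cons c t =>
      rw [h3] at ih
      simp only [deletionSeq, List.splitOnP_cons_eq_if_modifyHead, h3] at hb
      split_ifs at hb with hx
      · rcases List.mem_cons.1 hb with rfl | hb
        · simp at ha
        · have := ih b hb a ha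
          exact ⟨List.mem_cons_of_mem _ this.1, this.2⟩
      · simp only [decide_eq_true_eq] at hx
        simp only [List.modifyHead_cons, List.mem_cons] at hb
        rcases hb with rfl | hb
        · rcases List.mem_cons.1 ha with rfl | ha
          · exact ⟨List.mem_cons_self, hx⟩
          · have := ih c List.mem_cons_self a ha
            exact ⟨List.mem_cons_of_mem _ this.1, this.2⟩
        · have := ih b (List.mem_cons_of_mem _ hb) a ha
          exact ⟨List.mem_cons_of_mem _ this.1, this.2⟩

theorem lex_total_on {α : Type*} {r : α → α → Prop} {p : α → Prop}
    (h : ∀ a b, p a → p b → r a b ∨ a = b ∨ r b a) :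
    ∀ s t : List α, (∀ a ∈ s, p a) → (∀ a ∈ t, p a) →
      List.Lex r s t ∨ s = t ∨ List.Lex r t s
  | [], [], _, _ => Or.inr (Or.inl rfl)
  | [], _ :: _, _, _ => Or.inl List.Lex.nil
  | _ :: _, [], _, _ => Or.inr (Or.inr List.Lex.nil)
  | a :: s, b :: t, hs, ht => by
    rcases h a b (hs a List.mem_cons_self) (ht b List.mem_cons_self) with hab | rfl | hab
    · exact Or.inl (List.Lex.rel hab)
    · rcases lex_total_on h s t (fun c hc => hs c (List.mem_cons_of_mem _ hc))
        (fun c hc => ht c (List.mem_cons_of_mem _ hc)) with h1 | rfl | h1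
      · exact Or.inl (List.Lex.cons h1)
      · exact Or.inr (Or.inl rfl)
      · exact Or.inr (Or.inr (List.Lex.cons h1))
    · exact Or.inr (Or.inr (List.Lex.rel hab))

theorem levelLT_total (i : ℕ) (u v : List (Fin n)) (hu : ∀ a ∈ u, (a : ℕ) < i)
    (hv : ∀ a ∈ v, (a : ℕ) < i) : levelLT i u v ∨ u = v ∨ levelLT i v u := by
  induction i generalizing u v with
  | zero =>
    have e : ∀ w : List (Fin n), (∀ a ∈ w, (a : ℕ) < 0) → w = [] := fun w hw =>
      List.eq_nil_iff_forall_not_mem.2 fun a ha => absurd (hw a ha) (Nat.not_lt_zero _)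
    exact Or.inr (Or.inl ((e u hu).trans (e v hv).symm))
  | succ i ih =>
    have hp : ∀ w : List (Fin n), (∀ a ∈ w, (a : ℕ) < i + 1) →
        ∀ b ∈ deletionSeq i w, ∀ a ∈ b, (a : ℕ) < i := fun w hw b hb a ha => by
      have h := mem_deletionSeq i w b hb a ha
      have := hw a h.1
      omega
    simp only [levelLT, List.shortlex_def]
    rcases lt_trichotomy (deletionSeq i u).length (deletionSeq i v).length with h | h | h
    · exact Or.inl (Or.inl h)
    · rcases lex_total_on (p := fun b : List (Fin n) => ∀ a ∈ b, (a : ℕ) < i)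
        (fun a b ha hb => ih a b ha hb) (deletionSeq i u) (deletionSeq i v) (hp u hu) (hp v hv)
        with h1 | h1 | h1
      · exact Or.inl (Or.inr ⟨h, h1⟩)
      · exact Or.inr (Or.inl (deletionSeq_injective i h1))
      · exact Or.inr (Or.inr (Or.inr ⟨h.symm, h1⟩))
    · exact Or.inr (Or.inr (Or.inl h))

theorem wordLT_wf : WellFounded (wordLT (n := n)) := levelLT_wf n

theorem wordLT_total (u v : List (Fin n)) : wordLT u v ∨ u = v ∨ wordLT v u :=
  levelLT_total n u v (fun a _ => a.isLt) (fun a _ => a.isLt)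

end Facts

section Coxeter

variable {M : CoxeterMatrix (Fin n)} {W : Type*} [Group W] (cs : CoxeterSystem M W)

/-- The set `R(w)` of reduced words for `w`. -/
def reducedWords (w : W) : Set (List (Fin n)) :=
  {u | cs.IsReduced u ∧ cs.wordProd u = w}

/-- Every group element has a unique reduced word that precedes all its other reduced words
in the deletion order. -/
theorem existsUnique_least_reducedWord (w : W) :
    ∃! u, u ∈ reducedWords cs w ∧ ∀ v ∈ reducedWords cs w, v ≠ u → wordLT u v := by
  obtain ⟨u₀, h₀, e₀⟩ := cs.exists_isReduced w
  have hne : (reducedWords cs w).Nonempty := ⟨u₀, h₀, e₀.symm⟩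
  refine ⟨wordLT_wf.min _ hne, ⟨wordLT_wf.min_mem _ hne, fun v hv hvu => ?_⟩, ?_⟩
  · rcases wordLT_total (wordLT_wf.min _ hne) v with h | h | h
    · exact h
    · exact absurd h.symm hvu
    · exact absurd h (wordLT_wf.not_lt_min _ hv)
  · rintro v ⟨hv, hmin⟩
    by_contra hne'
    exact wordLT_wf.not_lt_min _ hv (hmin _ (wordLT_wf.min_mem _ hne) (Ne.symm hne'))

/-- The normal form `NF_Δ(w)`: the least reduced word for `w` in the deletion order. -/
noncomputable def normalForm (w : W) : List (Fin n) :=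
  (existsUnique_least_reducedWord cs w).choose

/-- The deletion order on the group: `u` precedes `v` if the normal form of `u` precedes that
of `v`. -/
def groupLT (u v : W) : Prop := wordLT (normalForm cs u) (normalForm cs v)

/-- The labelling given by the deletion order: `L(w) = |{u ∈ W | u < w}| + 1`. -/
noncomputable def label (w : W) : ℕ := {u : W | groupLT cs u w}.ncard + 1

/-- `ω` is an element of maximal length. -/
def IsLongest (ω : W) : Prop := ∀ w : W, cs.length w ≤ cs.length ω

end Coxeter

end DeletionOrder

namespace DeletionOrder

/-! ### Order properties of the deletion order and cutting at a letter. -/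

section Words

variable {n : ℕ}

/-! Let W_i be the parabolic subgroup on the first i generators. In types A and B the minimal
representatives of the cosets d W_i in W_{i+1} form a chain d_0 = 1, d_1, …, d_top with d_k of
length k, and each element of W_{i+1} is d_k p for exactly one k and one p in W_i. Iterating this
gives every element a mixed-radix rank r = k |W_i| + rank(p), and concatenating the words for the
representatives gives `rankWord`.

The words of rank 0, 1, 2, … increase in the deletion order (`levelLT_rankWord`). Each is the least
of all words for its element (`rankWord_le`), and it is reduced (`length_rankElt`). So it is the
normal form, and L is the rank plus one (`label_rankElt`). If ω_i is the longest element of W_i,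
then ω_{i+1} d_k = d_{top-k} ω_i. Hence left multiplication by the longest element complements every
digit and sends rank r to |W| - 1 - r (`longest_mul_rankElt`), which is the claim.

`IsCosetChain` collects what depends on the type. Its fields follow from the commutation and braid
relations, except that distinct d_k give distinct cosets: this is read off from an action on the
integers by permutations (type A) or signed permutations (type B). -/

theorem levelLT_irrefl (i : ℕ) (u : List (Fin n)) : ¬ levelLT i u u :=
  (levelLT_wf i).irrefl.irrefl u

theorem levelLT_asymm {i : ℕ} {u v : List (Fin n)} (h : levelLT i u v) : ¬ levelLT i v u :=
  (levelLT_wf i).asymmetric _ _ h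

theorem shortlex_trans {α : Type*} {r : α → α → Prop} (hr : ∀ {a b c}, r a b → r b c → r a c)
    {s t u : List α} (hst : List.Shortlex r s t) (htu : List.Shortlex r t u) :
    List.Shortlex r s u := by
  have lex_trans : ∀ {s t u : List α}, List.Lex r s t → List.Lex r t u → List.Lex r s u := by
    intro s t u h
    induction h generalizing u with
    | nil => intro h; cases h <;> exact List.Lex.nil
    | cons _ ih =>
      intro h
      cases h with
      | cons h => exact List.Lex.cons (ih h)
      | rel h => exact List.Lex.rel h
    | rel hab =>
      intro h
      cases h with
      | cons h => exact List.Lex.rel hab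
      | rel h => exact List.Lex.rel (hr hab h)
  rw [List.shortlex_def] at *
  rcases hst with h | ⟨h, h'⟩ <;> rcases htu with k | ⟨k, k'⟩
  · exact Or.inl (h.trans k)
  · exact Or.inl (k ▸ h)
  · exact Or.inl (h ▸ k)
  · exact Or.inr ⟨h.trans k, lex_trans h' k'⟩

theorem levelLT_trans {i : ℕ} {u v w : List (Fin n)} (huv : levelLT i u v) (hvw : levelLT i v w) :
    levelLT i u w := by
  induction i generalizing u v w with
  | zero => exact huv.elim
  | succ i ih => exact shortlex_trans (r := levelLT i) (fun h h' => ih h h') huv hvw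

theorem shortlex_cons_of_rel {α : Type*} {r : α → α → Prop} {a b : α} {s t : List α}
    (h : s.length = t.length) (hab : r a b) : List.Shortlex r (a :: s) (b :: t) :=
  List.Shortlex.of_lex (by simp [h]) (List.Lex.rel hab)

theorem shortlex_cons_of_shortlex {α : Type*} {r : α → α → Prop} {a : α} {s t : List α}
    (h : List.Shortlex r s t) : List.Shortlex r (a :: s) (a :: t) := by
  rw [List.shortlex_def] at *
  rcases h with h | ⟨h, h'⟩
  · exact Or.inl (by simpa using h)
  · exact Or.inr ⟨by simpa using h, List.Lex.cons h'⟩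

theorem deletionSeq_of_lt {i : ℕ} {u : List (Fin n)} (hu : ∀ a ∈ u, (a : ℕ) < i) :
    deletionSeq i u = [u] :=
  List.splitOnP_eq_singleton fun a ha => by simpa using (hu a ha).ne

theorem deletionSeq_append_cons {u v : List (Fin n)} {a : Fin n}
    (hu : ∀ b ∈ u, (b : ℕ) < a) : deletionSeq a (u ++ a :: v) = u :: deletionSeq a v :=
  List.splitOnP_append_cons_of_forall_mem (fun b hb => by simpa using (hu b hb).ne) a (by simp) v

/-- A word either avoids its largest letter or can be cut at the first occurrence of that letter. -/
theorem forall_lt_or_eq_append_cons {i : ℕ} {u : List (Fin n)} (hu : ∀ b ∈ u, (b : ℕ) < i + 1) :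
    (∀ b ∈ u, (b : ℕ) < i) ∨ ∃ (a : Fin n) (v w : List (Fin n)), (a : ℕ) = i ∧ u = v ++ a :: w ∧
      (∀ b ∈ v, (b : ℕ) < i) ∧ ∀ b ∈ w, (b : ℕ) < i + 1 := by
  by_cases h : ∀ b ∈ u, (b : ℕ) < i
  · exact Or.inl h
  · push Not at h
    obtain ⟨a, ha, hai⟩ := h
    have hai : (a : ℕ) = i := by have := hu a ha; omega
    obtain ⟨v, w, rfl, hv⟩ := List.eq_append_cons_of_mem ha
    refine Or.inr ⟨a, v, w, hai, rfl, fun b hb => ?_, fun b hb => hu b (by simp [hb])⟩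
    have h1 := hu b (by simp [hb])
    have h2 : (b : ℕ) ≠ a := fun e => hv (Fin.ext e ▸ hb)
    omega

theorem deletionSeq_length_pos (i : ℕ) (u : List (Fin n)) : 0 < (deletionSeq i u).length :=
  List.length_pos_iff.2 (List.splitOnP_ne_nil _ _)

/-- The bound on the letters is essential: level i never cuts at a letter from i on, so a word made
of such letters only is incomparable with the empty word. -/
theorem levelLT_nil {i : ℕ} {u : List (Fin n)} (hu : ∀ a ∈ u, (a : ℕ) < i) (h : u ≠ []) :
    levelLT i [] u := by
  induction i generalizing u with
  | zero =>
    obtain ⟨a, u, rfl⟩ := List.exists_cons_of_ne_nil h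
    exact absurd (hu a (by simp)) (by simp)
  | succ i ih =>
    rw [levelLT, deletionSeq_of_lt (u := []) (by simp)]
    rcases forall_lt_or_eq_append_cons hu with h' | ⟨a, v, w, rfl, rfl, hv, -⟩
    · rw [deletionSeq_of_lt h', List.shortlex_singleton_iff]
      exact ih h' h
    · rw [deletionSeq_append_cons hv]
      have := deletionSeq_length_pos a w
      exact List.Shortlex.of_length_lt (by simp; omega)

end Words

/-! ### Chain words, ranks, and monotonicity of rank words. -/

section Chains

/-- `top i` is one less than the length of the chain of cosets of the parabolic subgroup on
`i - 1` letters in the parabolic subgroup on `i` letters. -/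
structure IsChainLength (top : ℕ → ℕ) : Prop where
  zero : top 0 = 0
  succ : ∀ i, top (i + 1) = top i + 1 ∨ top (i + 1) = top i + 2

variable {n : ℕ} [NeZero n] (top : ℕ → ℕ)

theorem val_ofNat_of_lt {i : ℕ} (hi : i < n) : (Fin.ofNat n i : ℕ) = i := Nat.mod_eq_of_lt hi

/-- The words for the minimal coset representatives. -/
def chainWord (n : ℕ) [NeZero n] (top : ℕ → ℕ) : ℕ → ℕ → List (Fin n)
  | 0, _ => []
  | _ + 1, 0 => []
  | i + 1, k + 1 =>
    if k ≤ top i then chainWord n top i k ++ [Fin.ofNat n i]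
    else Fin.ofNat n i :: (chainWord n top i (top i) ++ [Fin.ofNat n i])

/-- The order of the parabolic subgroup on `i` letters. -/
def chainCard (top : ℕ → ℕ) : ℕ → ℕ
  | 0 => 1
  | i + 1 => (top (i + 1) + 1) * chainCard top i

/-- The normal forms on `i` letters, in increasing order. -/
def rankWord (n : ℕ) [NeZero n] (top : ℕ → ℕ) : ℕ → ℕ → List (Fin n)
  | 0, _ => []
  | i + 1, r =>
    chainWord n top (i + 1) (r / chainCard top i) ++ rankWord n top i (r % chainCard top i)

theorem chainCard_pos (i : ℕ) : 0 < chainCard top i := by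
  induction i with
  | zero => exact Nat.one_pos
  | succ i ih => exact Nat.mul_pos (Nat.succ_pos _) ih

variable {top}

@[simp] theorem chainWord_zero_right (i : ℕ) : chainWord n top i 0 = [] := by
  cases i <;> rfl

theorem chainWord_succ {i k : ℕ} (hk : k ≤ top i) :
    chainWord n top (i + 1) (k + 1) = chainWord n top i k ++ [Fin.ofNat n i] := if_pos hk

theorem chainWord_succ_of_lt {i k : ℕ} (hk : top i < k) :
    chainWord n top (i + 1) (k + 1) =
      Fin.ofNat n i :: (chainWord n top i (top i) ++ [Fin.ofNat n i]) := if_neg hk.not_ge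

theorem chainWord_lt {i : ℕ} (hi : i ≤ n) (k : ℕ) : ∀ a ∈ chainWord n top i k, (a : ℕ) < i := by
  induction i generalizing k with
  | zero => simp [chainWord]
  | succ i ih =>
    have hval := val_ofNat_of_lt hi
    have ih' : ∀ k, ∀ a ∈ chainWord n top i k, (a : ℕ) < i + 1 := fun k a ha =>
      (ih (Nat.le_of_succ_le hi) k a ha).trans (Nat.lt_succ_self i)
    cases k with
    | zero => simp
    | succ k =>
      intro a ha
      rw [chainWord] at ha
      split_ifs at ha <;> simp only [List.mem_append, List.mem_cons, List.not_mem_nil, or_false]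
        at ha
      · rcases ha with ha | rfl
        · exact ih' _ a ha
        · omega
      · rcases ha with rfl | ha | rfl
        · omega
        · exact ih' _ a ha
        · omega

theorem length_chainWord (ht : IsChainLength top) {i k : ℕ} (hk : k ≤ top i) :
    (chainWord n top i k).length = k := by
  induction i generalizing k with
  | zero => rw [ht.zero] at hk; simp [chainWord]; omega
  | succ i ih =>
    cases k with
    | zero => simp
    | succ k =>
      rcases le_or_gt k (top i) with h | h
      · simp [chainWord_succ h, ih h]
      · have := ht.succ i
        simp [chainWord_succ_of_lt h, ih le_rfl]
        omega

theorem exists_rank_eq {i r : ℕ} (hr : r < chainCard top (i + 1)) :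
    ∃ k p, k ≤ top (i + 1) ∧ p < chainCard top i ∧ r = k * chainCard top i + p :=
  ⟨r / chainCard top i, r % chainCard top i,
    Nat.lt_succ_iff.1 (Nat.div_lt_of_lt_mul (by rwa [Nat.mul_comm])),
    Nat.mod_lt _ (chainCard_pos top i), (Nat.div_add_mod' _ _).symm⟩

theorem rank_lt {i k p : ℕ} (hk : k ≤ top (i + 1)) (hp : p < chainCard top i) :
    k * chainCard top i + p < chainCard top (i + 1) := by
  rw [chainCard]
  nlinarith

theorem rankWord_succ (i k : ℕ) {p : ℕ} (hp : p < chainCard top i) :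
    rankWord n top (i + 1) (k * chainCard top i + p) =
      chainWord n top (i + 1) k ++ rankWord n top i p := by
  have h : (k * chainCard top i + p) / chainCard top i = k := by
    rw [Nat.mul_comm, Nat.mul_add_div (chainCard_pos top i), Nat.div_eq_of_lt hp, Nat.add_zero]
  rw [rankWord, Nat.mul_add_mod', Nat.mod_eq_of_lt hp, h]

@[simp] theorem rankWord_zero_right (i : ℕ) : rankWord n top i 0 = [] := by
  induction i with
  | zero => rfl
  | succ i ih => simp [rankWord, ih]

theorem rankWord_lt {i : ℕ} (hi : i ≤ n) (r : ℕ) : ∀ a ∈ rankWord n top i r, (a : ℕ) < i := by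
  induction i generalizing r with
  | zero => simp [rankWord]
  | succ i ih =>
    intro a ha
    rcases List.mem_append.1 ha with ha | ha
    · exact chainWord_lt hi _ a ha
    · exact (ih (Nat.le_of_succ_le hi) _ a ha).trans (Nat.lt_succ_self i)

theorem deletionSeq_chainWord_succ_append {i : ℕ} (hi : i < n) {v : List (Fin n)}
    (hv : ∀ a ∈ v, (a : ℕ) < i) {k : ℕ} (hk : k ≤ top i) :
    deletionSeq i (chainWord n top (i + 1) (k + 1) ++ v) = [chainWord n top i k, v] := by
  have hval := val_ofNat_of_lt hi
  have := deletionSeq_append_cons (a := Fin.ofNat n i) (v := v)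
    (hval.symm ▸ chainWord_lt (top := top) hi.le k)
  rw [hval] at this
  rw [chainWord_succ hk, List.append_assoc, List.singleton_append, this, deletionSeq_of_lt hv]

theorem deletionSeq_chainWord_succ_append_of_lt {i : ℕ} (hi : i < n) {v : List (Fin n)}
    (hv : ∀ a ∈ v, (a : ℕ) < i) {k : ℕ} (hk : top i < k) :
    deletionSeq i (chainWord n top (i + 1) (k + 1) ++ v) =
      [[], chainWord n top i (top i), v] := by
  have hval := val_ofNat_of_lt hi
  have h1 := deletionSeq_append_cons (a := Fin.ofNat n i) (v := v)
    (hval.symm ▸ chainWord_lt (top := top) hi.le (top i))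
  have h2 := deletionSeq_append_cons (a := Fin.ofNat n i) (u := [])
    (v := chainWord n top i (top i) ++ Fin.ofNat n i :: v) (by simp)
  rw [hval] at h1 h2
  rw [List.nil_append, h1, deletionSeq_of_lt hv] at h2
  rw [chainWord_succ_of_lt hk, List.cons_append, List.append_assoc, List.singleton_append, h2]

/-- Chain words are the rank words with trivial second factor, so comparisons of rank words also
compare chain words. -/
theorem chainWord_eq_rankWord (i k : ℕ) :
    chainWord n top (i + 1) k = rankWord n top (i + 1) (k * chainCard top i) := by
  simpa using (rankWord_succ (n := n) i k (chainCard_pos top i)).symm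

theorem rank_lt_rank_iff {c k p k' p' : ℕ} (hp : p < c) (hp' : p' < c) :
    k * c + p < k' * c + p' ↔ k < k' ∨ k = k' ∧ p < p' := by
  rcases lt_trichotomy k k' with h | rfl | h
  · have := Nat.mul_le_mul_right c (Nat.succ_le_of_lt h)
    rw [Nat.succ_mul] at this
    exact ⟨fun _ => Or.inl h, fun _ => by omega⟩
  · simp
  · have := Nat.mul_le_mul_right c (Nat.succ_le_of_lt h)
    rw [Nat.succ_mul] at this
    constructor <;> intro <;> omega

/-- Write a rank as (k, p), let q be the rank word of p, and let c_m be the chain word of length m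
one level down. The deletion sequence is [q] for k = 0, [c_{k-1}, q] for 1 ≤ k ≤ top i + 1, and [[],
c_top, q] for k = top i + 2. These increase with (k, p) lexicographically, because the c_m increase
with m by induction. -/
theorem levelLT_rankWord (ht : IsChainLength top) {i : ℕ} (hi : i ≤ n) {r r' : ℕ} (h : r < r')
    (hr' : r' < chainCard top i) :
    levelLT i (rankWord n top i r) (rankWord n top i r') := by
  induction i generalizing r r' with
  | zero => simp [chainCard] at hr'; omega
  | succ i ih =>
    have hin : i ≤ n := Nat.le_of_succ_le hi
    obtain ⟨k, p, hk, hp, rfl⟩ := exists_rank_eq (h.trans hr')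
    obtain ⟨k', p', hk', hp', rfl⟩ := exists_rank_eq hr'
    have hv := rankWord_lt (top := top) hin p
    have hv' := rankWord_lt (top := top) hin p'
    rw [rankWord_succ _ _ hp, rankWord_succ _ _ hp', levelLT]
    rcases (rank_lt_rank_iff hp hp').1 h with hkk | ⟨rfl, hpp⟩
    · obtain ⟨k', rfl⟩ := Nat.exists_eq_add_one_of_ne_zero (Nat.ne_of_gt (Nat.zero_lt_of_lt hkk))
      rcases k with _ | k
      · rw [chainWord_zero_right, List.nil_append, deletionSeq_of_lt hv]
        refine List.Shortlex.of_length_lt ?_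
        rcases le_or_gt k' (top i) with h' | h'
        · simp [deletionSeq_chainWord_succ_append hi hv' h']
        · simp [deletionSeq_chainWord_succ_append_of_lt hi hv' h']
      · have hki : k ≤ top i := by have := ht.succ i; omega
        rw [deletionSeq_chainWord_succ_append hi hv hki]
        rcases le_or_gt k' (top i) with h' | h'
        · rw [deletionSeq_chainWord_succ_append hi hv' h']
          refine shortlex_cons_of_rel rfl ?_
          -- Level 0 has a single chain word, so two different ones exist only at a successor level,
          -- where chain words are rank words.
          rcases i with _ | i
          · have := ht.zero; omega
          · rw [chainWord_eq_rankWord, chainWord_eq_rankWord]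
            exact ih hin (Nat.mul_lt_mul_of_pos_right (by omega) (chainCard_pos top i))
              (by simpa using rank_lt h' (chainCard_pos top i))
        · rw [deletionSeq_chainWord_succ_append_of_lt hi hv' h']
          exact List.Shortlex.of_length_lt (by simp)
    · have key := ih hin hpp hp'
      rcases k with _ | k
      · simpa [deletionSeq_of_lt hv, deletionSeq_of_lt hv'] using key
      · rcases le_or_gt k (top i) with h' | h'
        · rw [deletionSeq_chainWord_succ_append hi hv h',
            deletionSeq_chainWord_succ_append hi hv' h']
          exact shortlex_cons_of_shortlex ((List.shortlex_singleton_iff _ _).2 key)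
        · rw [deletionSeq_chainWord_succ_append_of_lt hi hv h',
            deletionSeq_chainWord_succ_append_of_lt hi hv' h']
          exact shortlex_cons_of_shortlex
            (shortlex_cons_of_shortlex ((List.shortlex_singleton_iff _ _).2 key))

theorem chainWord_le_rankWord (ht : IsChainLength top) {i : ℕ} (hi : i + 1 ≤ n) {k p : ℕ}
    (hk : k ≤ top (i + 1)) (hp : p < chainCard top i) :
    chainWord n top (i + 1) k = rankWord n top (i + 1) (k * chainCard top i + p) ∨
      levelLT (i + 1) (chainWord n top (i + 1) k)
        (rankWord n top (i + 1) (k * chainCard top i + p)) := by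
  rw [chainWord_eq_rankWord]
  rcases Nat.eq_zero_or_pos p with rfl | h
  · exact Or.inl rfl
  · exact Or.inr (levelLT_rankWord ht hi (by omega) (rank_lt hk hp))

end Chains

/-! ### Consequences of the coset chain: normal forms, labels, longest element. -/

section CosetChains

variable {n : ℕ} [NeZero n] {M : CoxeterMatrix (Fin n)} {W : Type*} [Group W]
  (cs : CoxeterSystem M W) (top : ℕ → ℕ)

/-- The generator with number `i`. -/
def gen (i : ℕ) : W := cs.simple (Fin.ofNat n i)

/-- The minimal coset representatives of consecutive standard parabolic subgroups. -/
def chainRep (i k : ℕ) : W := cs.wordProd (chainWord n top i k)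

/-- The elements on `i` letters, in increasing order. -/
def rankElt (i r : ℕ) : W := cs.wordProd (rankWord n top i r)

/-- The longest element on `i` letters. -/
def longest (i : ℕ) : W := rankElt cs top i (chainCard top i - 1)

/-- The minimal representatives of the cosets of the parabolic subgroup on `i` letters in the one on
`i + 1` letters form a chain, which is reversed by the longest element. -/
structure IsCosetChain : Prop extends IsChainLength top where
  comm : ∀ {i j : ℕ}, i < n → j + 1 < i → Commute (gen cs j) (gen cs i)
  -- Deodhar's lemma for a chain: a generator moves d_k to a neighbour or slides through it,
  -- becoming a generator of the smaller subgroup.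
  step : ∀ {i j k : ℕ}, i < n → j ≤ i → k ≤ top (i + 1) →
    (∃ k' ≤ top (i + 1), (k' = k + 1 ∨ k = k' + 1) ∧
      gen cs j * chainRep cs top (i + 1) k = chainRep cs top (i + 1) k') ∨
    ∃ j' < i, gen cs j * chainRep cs top (i + 1) k = chainRep cs top (i + 1) k * gen cs j'
  sep : ∀ {i k k' : ℕ} {u v : List (Fin n)}, i < n → k ≤ top (i + 1) → k' ≤ top (i + 1) →
    (∀ a ∈ u, (a : ℕ) < i) → (∀ a ∈ v, (a : ℕ) < i) →
    chainRep cs top (i + 1) k * cs.wordProd u = chainRep cs top (i + 1) k' * cs.wordProd v → k = k'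
  reversal : ∀ {i k : ℕ}, i < n → k ≤ top (i + 1) →
    longest cs top (i + 1) * chainRep cs top (i + 1) k =
      chainRep cs top (i + 1) (top (i + 1) - k) * longest cs top i

@[simp] theorem gen_mul_self (i : ℕ) : gen cs i * gen cs i = 1 := cs.simple_mul_simple_self _

@[simp] theorem gen_mul_gen_mul (i : ℕ) (w : W) : gen cs i * (gen cs i * w) = w :=
  cs.simple_mul_simple_cancel_left _

theorem simple_eq_gen (a : Fin n) : cs.simple a = gen cs a := by
  simp [gen]

variable {cs top}

@[simp] theorem chainRep_zero_right (i : ℕ) : chainRep cs top i 0 = 1 := by simp [chainRep]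

theorem chainRep_succ {i k : ℕ} (hk : k ≤ top i) :
    chainRep cs top (i + 1) (k + 1) = chainRep cs top i k * gen cs i := by
  simp [chainRep, chainWord_succ hk, cs.wordProd_append, gen]

theorem chainRep_succ_of_lt {i k : ℕ} (hk : top i < k) :
    chainRep cs top (i + 1) (k + 1) = gen cs i * (chainRep cs top i (top i) * gen cs i) := by
  simp [chainRep, chainWord_succ_of_lt hk, cs.wordProd_append, cs.wordProd_cons, gen]

@[simp] theorem rankElt_zero_right (i : ℕ) : rankElt cs top i 0 = 1 := by simp [rankElt]

theorem rankElt_succ (i k : ℕ) {p : ℕ} (hp : p < chainCard top i) :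
    rankElt cs top (i + 1) (k * chainCard top i + p) =
      chainRep cs top (i + 1) k * rankElt cs top i p := by
  rw [rankElt, rankWord_succ i k hp, cs.wordProd_append]
  rfl

theorem chainCard_succ_sub_one (i : ℕ) :
    chainCard top (i + 1) - 1 = top (i + 1) * chainCard top i + (chainCard top i - 1) := by
  have := chainCard_pos top i
  rw [chainCard, Nat.succ_mul]
  omega

theorem longest_succ (i : ℕ) :
    longest cs top (i + 1) = chainRep cs top (i + 1) (top (i + 1)) * longest cs top i := by
  rw [longest, chainCard_succ_sub_one, rankElt_succ _ _ (Nat.sub_lt (chainCard_pos top i) one_pos)]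
  rfl

theorem commute_wordProd {i : ℕ} {w : W} (hw : ∀ j < i, Commute (gen cs j) w) {u : List (Fin n)}
    (hu : ∀ a ∈ u, (a : ℕ) < i) : Commute (cs.wordProd u) w := by
  induction u with
  | nil => simp
  | cons a u ih =>
    rw [cs.wordProd_cons, simple_eq_gen]
    exact (hw a (hu a (by simp))).mul_left (ih fun b hb => hu b (by simp [hb]))

namespace IsCosetChain

theorem length_rankWord_succ (h : IsCosetChain cs top) {i k p : ℕ} (hk : k ≤ top (i + 1))
    (hp : p < chainCard top i) : (rankWord n top (i + 1) (k * chainCard top i + p)).length =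
      k + (rankWord n top i p).length := by
  rw [rankWord_succ i k hp, List.length_append, length_chainWord h.toIsChainLength hk]

/-- The generator either shifts the leading digit by one, or slides through the coset representative
and acts on the remaining digits, where induction applies. -/
theorem gen_mul_rankElt (h : IsCosetChain cs top) {i j r : ℕ} (hi : i ≤ n) (hj : j < i)
    (hr : r < chainCard top i) :
    ∃ r' < chainCard top i, gen cs j * rankElt cs top i r = rankElt cs top i r' ∧
      (rankWord n top i r').length ≤ (rankWord n top i r).length + 1 := by
  induction i generalizing j r with
  | zero => omega
  | succ i ih =>
    obtain ⟨k, p, hk, hp, rfl⟩ := exists_rank_eq hr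
    rw [h.length_rankWord_succ hk hp, rankElt_succ _ _ hp]
    rcases h.step hi (Nat.le_of_lt_succ hj) hk with ⟨k', hk', hkk, e⟩ | ⟨j', hj', e⟩
    · refine ⟨_, rank_lt hk' hp, ?_, ?_⟩
      · rw [rankElt_succ _ _ hp, ← mul_assoc, e]
      · rw [h.length_rankWord_succ hk' hp]
        omega
    · obtain ⟨p', hp', e', hl⟩ := ih (Nat.le_of_succ_le hi) hj' hp
      refine ⟨_, rank_lt hk hp', ?_, ?_⟩
      · rw [rankElt_succ _ _ hp', ← mul_assoc, e, mul_assoc, e']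
      · rw [h.length_rankWord_succ hk hp']
        omega

/-- The letters of the word are absorbed one at a time from the right. The length bound is what
later shows that rank words are reduced. -/
theorem exists_rank (h : IsCosetChain cs top) {i : ℕ} (hi : i ≤ n) {u : List (Fin n)}
    (hu : ∀ a ∈ u, (a : ℕ) < i) :
    ∃ r < chainCard top i, cs.wordProd u = rankElt cs top i r ∧
      (rankWord n top i r).length ≤ u.length := by
  induction u with
  | nil => exact ⟨0, chainCard_pos top i, by simp, by simp⟩
  | cons a u ih =>
    obtain ⟨r, hr, e, hl⟩ := ih fun b hb => hu b (by simp [hb])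
    obtain ⟨r', hr', e', hl'⟩ := h.gen_mul_rankElt hi (hu a (by simp)) hr
    refine ⟨r', hr', ?_, hl'.trans (by simpa using hl)⟩
    rw [cs.wordProd_cons, e, simple_eq_gen, e']

theorem rankElt_inj (h : IsCosetChain cs top) {i r r' : ℕ} (hi : i ≤ n) (hr : r < chainCard top i)
    (hr' : r' < chainCard top i) (e : rankElt cs top i r = rankElt cs top i r') : r = r' := by
  induction i generalizing r r' with
  | zero => simp [chainCard] at hr hr'; omega
  | succ i ih =>
    have hin : i ≤ n := Nat.le_of_succ_le hi
    obtain ⟨k, p, hk, hp, rfl⟩ := exists_rank_eq hr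
    obtain ⟨k', p', hk', hp', rfl⟩ := exists_rank_eq hr'
    rw [rankElt_succ _ _ hp, rankElt_succ _ _ hp'] at e
    obtain rfl := h.sep hi hk hk' (rankWord_lt hin p) (rankWord_lt hin p') e
    rw [ih hin hp hp' (mul_left_cancel e)]

/-- If `u` and `v` are words on smaller letters, then the minimal representative of the coset of
`u i v` comes from a chain word that does not exceed `u`. -/
theorem exists_chainWord_le (h : IsCosetChain cs top) {i : ℕ} (hi : i < n) {u v : List (Fin n)}
    (hu : ∀ a ∈ u, (a : ℕ) < i) (hv : ∀ a ∈ v, (a : ℕ) < i)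
    (hle : ∀ r < chainCard top i, cs.wordProd u = rankElt cs top i r →
      rankWord n top i r = u ∨ levelLT i (rankWord n top i r) u) :
    ∃ k ≤ top i, (chainWord n top i k = u ∨ levelLT i (chainWord n top i k) u) ∧
      ∃ w : List (Fin n), (∀ a ∈ w, (a : ℕ) < i) ∧
        cs.wordProd u * (gen cs i * cs.wordProd v) =
          chainRep cs top (i + 1) (k + 1) * cs.wordProd w := by
  rcases i with _ | i
  · obtain rfl := List.eq_nil_iff_forall_not_mem.2 fun a ha => Nat.not_lt_zero _ (hu a ha)
    refine ⟨0, Nat.zero_le _, Or.inl (by simp), v, hv, ?_⟩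
    rw [chainRep_succ (Nat.zero_le _)]
    simp
  · obtain ⟨r, hr, e, -⟩ := h.exists_rank hi.le hu
    have hru := hle r hr e
    obtain ⟨k, p, hk, hp, rfl⟩ := exists_rank_eq hr
    have hp_lt := rankWord_lt (n := n) (top := top) (i := i) (by omega) p
    refine ⟨k, hk, ?_, rankWord n top i p ++ v, ?_, ?_⟩
    -- Dropping the second factor of the rank word cannot increase it, and the rank word does not
    -- exceed `u`.
    · rcases chainWord_le_rankWord h.toIsChainLength hi.le hk hp with h1 | h1
      · rwa [h1]
      · rcases hru with h2 | h2
        · exact Or.inr (h2 ▸ h1)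
        · exact Or.inr (levelLT_trans h1 h2)
    · intro a ha
      rcases List.mem_append.1 ha with ha | ha
      · exact (hp_lt a ha).trans (Nat.lt_succ_self i)
      · exact hv a ha
    -- The second factor of `u` uses only letters not adjacent to the new generator, so it moves
    -- past it and joins `v`.
    · have hc := (commute_wordProd (fun j hj => h.comm hi (Nat.succ_lt_succ hj)) hp_lt).eq
      rw [e, rankElt_succ _ _ hp, chainRep_succ hk, cs.wordProd_append, rankElt]
      simp only [← mul_assoc]
      rw [mul_assoc (chainRep cs top (i + 1) k), hc, ← mul_assoc]

/-- The word of rank `r` is the least of all words representing the same element. -/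
theorem rankWord_le (h : IsCosetChain cs top) {i : ℕ} (hi : i ≤ n) {u : List (Fin n)}
    (hu : ∀ a ∈ u, (a : ℕ) < i) {r : ℕ} (hr : r < chainCard top i)
    (e : cs.wordProd u = rankElt cs top i r) :
    rankWord n top i r = u ∨ levelLT i (rankWord n top i r) u := by
  induction i generalizing u r with
  | zero =>
    refine Or.inl ?_
    rw [List.eq_nil_iff_forall_not_mem.2 fun a ha => absurd (hu a ha) (Nat.not_lt_zero _)]
    rfl
  | succ i ih =>
    have hin : i ≤ n := Nat.le_of_succ_le hi
    obtain ⟨k, p, hk, hp, rfl⟩ := exists_rank_eq hr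
    have hp_lt := rankWord_lt (n := n) (top := top) hin p
    rw [rankElt_succ _ _ hp] at e
    rw [rankWord_succ _ _ hp]
    have main : deletionSeq i (chainWord n top (i + 1) k ++ rankWord n top i p) = deletionSeq i u ∨
        List.Shortlex (levelLT i) (deletionSeq i (chainWord n top (i + 1) k ++ rankWord n top i p))
          (deletionSeq i u) := by
      -- The argument splits by the number of occurrences of the largest letter in `u`: none, one,
      -- two, or more. The rank word has at most two.
      rcases forall_lt_or_eq_append_cons hu with hui | ⟨a, v, w, hai, rfl, hv, hw⟩
      · obtain rfl := h.sep (k := k) (k' := 0) hi hk (Nat.zero_le _) hp_lt hui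
          (by simpa [rankElt] using e.symm)
        rw [deletionSeq_of_lt hui, chainWord_zero_right, List.nil_append, deletionSeq_of_lt hp_lt]
        rcases ih hin hui hp (by simpa using e) with h1 | h1
        · exact Or.inl (by rw [h1])
        · exact Or.inr ((List.shortlex_singleton_iff _ _).2 h1)
      subst hai
      have hw_pos := deletionSeq_length_pos a w
      rw [cs.wordProd_append, cs.wordProd_cons, simple_eq_gen] at e
      rw [deletionSeq_append_cons hv]
      rcases k with _ | k
      · rw [chainWord_zero_right, List.nil_append, deletionSeq_of_lt hp_lt]
        exact Or.inr (List.Shortlex.of_length_lt (by simp; omega))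
      rcases forall_lt_or_eq_append_cons hw with hwi | ⟨a', v', w', hai, rfl, hv', hw'⟩
      -- One occurrence: the coset of `u` determines the chain word, which is at most the first
      -- block. If they agree, cancelling them leaves the last blocks to compare by induction.
      · obtain ⟨k', hk', hle, d, hd, e'⟩ := h.exists_chainWord_le hi hv hwi
          fun r hr e => ih hin hv hr e
        obtain rfl : k' = k := by
          have := h.sep hi hk (by have := h.succ a; omega) hp_lt hd (e.symm.trans e')
          omega
        rw [deletionSeq_chainWord_succ_append hi hp_lt hk', deletionSeq_of_lt hwi]
        rcases hle with rfl | hlt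
        · rw [← mul_assoc, ← chainRep, ← chainRep_succ hk'] at e
          rcases ih hin hwi hp (mul_left_cancel e) with h1 | h1
          · exact Or.inl (by rw [h1])
          · exact Or.inr (shortlex_cons_of_shortlex ((List.shortlex_singleton_iff _ _).2 h1))
        · exact Or.inr (shortlex_cons_of_rel rfl hlt)
      · obtain rfl := Fin.ext hai
        have hw'_pos := deletionSeq_length_pos a' w'
        rw [deletionSeq_append_cons hv']
        rcases le_or_gt k (top a') with hka | hka
        · rw [deletionSeq_chainWord_succ_append hi hp_lt hka]
          exact Or.inr (List.Shortlex.of_length_lt (by simp; omega))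
        rw [deletionSeq_chainWord_succ_append_of_lt hi hp_lt hka]
        rcases forall_lt_or_eq_append_cons hw' with hwi | ⟨a, v'', w'', hai, rfl, hv'', -⟩
        · rw [deletionSeq_of_lt hwi]
          -- Two occurrences on both sides: the first block of the rank word is empty, so only an
          -- empty first block of `u` needs work. Then the leading generator cancels and the case of
          -- one occurrence remains.
          by_cases hnil : v = []
          · subst hnil
            rw [cs.wordProd_nil, one_mul, cs.wordProd_append, cs.wordProd_cons, simple_eq_gen,
              chainRep_succ_of_lt hka, mul_assoc] at e
            replace e := mul_left_cancel e
            obtain ⟨k', hk', hle, d, hd, e'⟩ := h.exists_chainWord_le hi hv' hwi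
              fun r hr e => ih hin hv' hr e
            obtain rfl : k' = top a' := by
              rw [e', ← chainRep_succ le_rfl] at e
              have := h.sep hi (by omega) (by omega) hd hp_lt e
              omega
            rcases hle with rfl | hlt
            · rw [← mul_assoc, ← chainRep] at e
              rcases ih hin hwi hp (mul_left_cancel e) with h1 | h1
              · exact Or.inl (by rw [h1])
              · exact Or.inr (shortlex_cons_of_shortlex (shortlex_cons_of_shortlex
                  ((List.shortlex_singleton_iff _ _).2 h1)))
            · exact Or.inr (shortlex_cons_of_shortlex (shortlex_cons_of_rel rfl hlt))
          · exact Or.inr (shortlex_cons_of_rel rfl (levelLT_nil hv hnil))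
        · obtain rfl := Fin.ext hai
          have := deletionSeq_length_pos a w''
          rw [deletionSeq_append_cons hv'']
          exact Or.inr (List.Shortlex.of_length_lt (by simp; omega))
    exact main.imp_left fun e => deletionSeq_injective i e

/-- A reduced word of the element yields a rank word that is no longer, and ranks are unique. -/
theorem length_rankElt (h : IsCosetChain cs top) {r : ℕ} (hr : r < chainCard top n) :
    cs.length (rankElt cs top n r) = (rankWord n top n r).length := by
  refine (cs.length_wordProd_le _).antisymm ?_
  obtain ⟨u, hu, e⟩ := cs.exists_isReduced (rankElt cs top n r)
  obtain ⟨r', hr', e', hl⟩ := h.exists_rank le_rfl (u := u) fun a _ => a.isLt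
  rw [← rankElt, e, hu.eq, h.rankElt_inj le_rfl hr hr' (e.trans e')]
  exact hl

theorem normalForm_rankElt (h : IsCosetChain cs top) {r : ℕ} (hr : r < chainCard top n) :
    normalForm cs (rankElt cs top n r) = rankWord n top n r := by
  refine (existsUnique_least_reducedWord cs (rankElt cs top n r)).unique
    (existsUnique_least_reducedWord cs (rankElt cs top n r)).choose_spec.1
    ⟨⟨h.length_rankElt hr, rfl⟩, fun v hv hne => ?_⟩
  exact (h.rankWord_le le_rfl (fun a _ => a.isLt) hr hv.2).resolve_left hne.symm

theorem groupLT_rankElt (h : IsCosetChain cs top) {r r' : ℕ} (hr : r < chainCard top n)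
    (hr' : r' < chainCard top n) :
    groupLT cs (rankElt cs top n r) (rankElt cs top n r') ↔ r < r' := by
  rw [groupLT, h.normalForm_rankElt hr, h.normalForm_rankElt hr', wordLT]
  refine ⟨fun hlt => ?_, fun hlt => levelLT_rankWord h.toIsChainLength le_rfl hlt hr'⟩
  by_contra hle
  rcases (Nat.le_of_not_lt hle).eq_or_lt with rfl | hgt
  · exact levelLT_irrefl _ _ hlt
  · exact levelLT_asymm hlt (levelLT_rankWord h.toIsChainLength le_rfl hgt hr)

theorem exists_rankElt_eq (h : IsCosetChain cs top) (w : W) :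
    ∃ r < chainCard top n, rankElt cs top n r = w := by
  obtain ⟨u, rfl⟩ := cs.wordProd_surjective w
  obtain ⟨r, hr, e, -⟩ := h.exists_rank le_rfl (u := u) fun a _ => a.isLt
  exact ⟨r, hr, e.symm⟩

theorem image_rankElt (h : IsCosetChain cs top) :
    rankElt cs top n '' Set.Iio (chainCard top n) = Set.univ :=
  Set.eq_univ_of_forall fun w => h.exists_rankElt_eq w

theorem injOn_rankElt (h : IsCosetChain cs top) :
    Set.InjOn (rankElt cs top n) (Set.Iio (chainCard top n)) :=
  fun _ hr _ hr' e => h.rankElt_inj le_rfl hr hr' e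

theorem finite (h : IsCosetChain cs top) : Finite W :=
  Set.finite_univ_iff.1 (h.image_rankElt ▸ (Set.finite_Iio _).image _)

theorem card_eq (h : IsCosetChain cs top) : Nat.card W = chainCard top n := by
  rw [← Set.ncard_univ, ← h.image_rankElt, h.injOn_rankElt.ncard_image, Set.ncard_eq_toFinset_card']
  simp

theorem label_rankElt (h : IsCosetChain cs top) {r : ℕ} (hr : r < chainCard top n) :
    label cs (rankElt cs top n r) = r + 1 := by
  have : {u | groupLT cs u (rankElt cs top n r)} = rankElt cs top n '' Set.Iio r := by
    ext w
    obtain ⟨r', hr', rfl⟩ := h.exists_rankElt_eq w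
    rw [Set.mem_ofPred_eq, h.groupLT_rankElt hr' hr]
    refine ⟨fun hlt => ⟨r', hlt, rfl⟩, ?_⟩
    rintro ⟨r'', hlt, e⟩
    rw [← h.rankElt_inj le_rfl (hlt.trans hr) hr' e]
    exact hlt
  rw [label, this, (h.injOn_rankElt.mono (Set.Iio_subset_Iio hr.le)).ncard_image,
    Set.ncard_eq_toFinset_card']
  simp

/-- The length is the sum of the digits of the rank, so it is maximal only when every digit is. -/
theorem length_rankWord_lt (h : IsCosetChain cs top) {i r : ℕ} (hr : r < chainCard top i - 1) :
    (rankWord n top i r).length < (rankWord n top i (chainCard top i - 1)).length := by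
  induction i generalizing r with
  | zero => simp [chainCard] at hr
  | succ i ih =>
    obtain ⟨k, p, hk, hp, rfl⟩ := exists_rank_eq (hr.trans_le (Nat.sub_le _ _))
    have hpos := chainCard_pos top i
    have hp' : chainCard top i - 1 < chainCard top i := by omega
    rw [chainCard_succ_sub_one] at hr ⊢
    rw [h.length_rankWord_succ hk hp, h.length_rankWord_succ le_rfl hp']
    rcases (rank_lt_rank_iff hp hp').1 hr with hlt | ⟨rfl, hlt⟩
    · rcases (Nat.le_sub_one_of_lt hp).eq_or_lt with rfl | hlt'
      · omega
      · have := ih hlt'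
        omega
    · have := ih hlt
      omega

theorem isLongest_iff (h : IsCosetChain cs top) {w : W} :
    IsLongest cs w ↔ w = longest cs top n := by
  have hpos := chainCard_pos top n
  have hlt : chainCard top n - 1 < chainCard top n := by omega
  have key : ∀ v, v ≠ longest cs top n → cs.length v < cs.length (longest cs top n) := by
    intro v hv
    obtain ⟨r, hr, rfl⟩ := h.exists_rankElt_eq v
    rw [longest, h.length_rankElt hr, h.length_rankElt hlt]
    refine h.length_rankWord_lt ((Nat.le_sub_one_of_lt hr).lt_of_ne ?_)
    rintro rfl
    exact hv rfl
  constructor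
  · intro hw
    by_contra hne
    exact (key w hne).not_ge (hw _)
  · rintro rfl v
    by_cases hv : v = longest cs top n
    · rw [hv]
    · exact (key v hv).le

/-- Reversal complements the leading digit and leaves the longest element of the smaller subgroup to
act on the rest. -/
theorem longest_mul_rankElt (h : IsCosetChain cs top) {i r : ℕ} (hi : i ≤ n)
    (hr : r < chainCard top i) :
    longest cs top i * rankElt cs top i r = rankElt cs top i (chainCard top i - 1 - r) := by
  induction i generalizing r with
  | zero => simp [chainCard] at hr; simp [hr, longest, chainCard]
  | succ i ih =>
    obtain ⟨k, p, hk, hp, rfl⟩ := exists_rank_eq hr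
    have e : chainCard top (i + 1) - 1 - (k * chainCard top i + p) =
        (top (i + 1) - k) * chainCard top i + (chainCard top i - 1 - p) := by
      rw [chainCard_succ_sub_one, Nat.sub_mul]
      have := Nat.mul_le_mul_right (chainCard top i) hk
      omega
    rw [e, rankElt_succ _ _ hp, rankElt_succ _ _ (by omega), ← mul_assoc, h.reversal hi hk,
      mul_assoc, ih (Nat.le_of_succ_le hi) hp]

theorem label_add_label (h : IsCosetChain cs top) (w : W) :
    label cs w + label cs (longest cs top n * w) = Nat.card W + 1 := by
  obtain ⟨r, hr, rfl⟩ := h.exists_rankElt_eq w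
  rw [h.longest_mul_rankElt le_rfl hr, h.label_rankElt hr, h.label_rankElt (by omega), h.card_eq]
  omega

end IsCosetChain
end CosetChains

/-! ### Braid relations and the (signed) permutation actions on the integers. -/

section Relations

theorem mul_pow_two_of_commute {G : Type*} [Monoid G] {a b : G} (ha : a * a = 1) (hb : b * b = 1)
    (h : a * b = b * a) : (a * b) ^ 2 = 1 := by
  rw [pow_two, mul_assoc, ← mul_assoc b, ← h, mul_assoc, hb, mul_one, ha]

theorem mul_pow_three_of_braid {G : Type*} [Monoid G] {a b : G} (ha : a * a = 1) (hb : b * b = 1)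
    (h : a * b * a = b * a * b) : (a * b) ^ 3 = 1 := by
  have : (a * b) ^ 3 = a * b * a * (b * a * b) := by
    simp only [pow_succ, pow_zero, one_mul, mul_assoc]
  rw [this, ← h]
  calc a * b * a * (a * b * a) = a * b * (a * a) * (b * a) := by simp only [mul_assoc]
    _ = a * (b * b) * a := by rw [ha, mul_one]; simp only [mul_assoc]
    _ = 1 := by rw [hb, mul_one, ha]

theorem mul_pow_four_of_braid {G : Type*} [Monoid G] {a b : G} (ha : a * a = 1) (hb : b * b = 1)
    (h : a * b * a * b = b * a * b * a) : (a * b) ^ 4 = 1 := by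
  have : (a * b) ^ 4 = a * b * a * b * (a * b * a * b) := by
    simp only [pow_succ, pow_zero, one_mul, mul_assoc]
  rw [this]
  nth_rewrite 2 [h]
  calc a * b * a * b * (b * a * b * a) = a * b * a * (b * b) * (a * b * a) := by
        simp only [mul_assoc]
    _ = a * b * (a * a) * (b * a) := by rw [hb, mul_one]; simp only [mul_assoc]
    _ = a * (b * b) * a := by rw [ha, mul_one]; simp only [mul_assoc]
    _ = 1 := by rw [hb, mul_one, ha]

theorem commute_of_mul_pow_two {G : Type*} [Group G] {a b : G} (ha : a * a = 1) (hb : b * b = 1)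
    (h : (a * b) ^ 2 = 1) : Commute a b := by
  have ha' : a⁻¹ = a := inv_eq_of_mul_eq_one_left ha
  have hb' : b⁻¹ = b := inv_eq_of_mul_eq_one_left hb
  rw [pow_two, ← eq_inv_iff_mul_eq_one] at h
  rwa [mul_inv_rev, ha', hb'] at h

theorem braid_of_mul_pow_three {G : Type*} [Group G] {a b : G} (ha : a * a = 1) (hb : b * b = 1)
    (h : (a * b) ^ 3 = 1) : a * b * a = b * a * b := by
  have ha' : a⁻¹ = a := inv_eq_of_mul_eq_one_left ha
  have hb' : b⁻¹ = b := inv_eq_of_mul_eq_one_left hb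
  have : a * b * a * (b * a * b) = 1 := by
    rw [← h]
    simp only [pow_succ, pow_zero, one_mul, mul_assoc]
  rw [← eq_inv_iff_mul_eq_one] at this
  simpa [mul_inv_rev, ha', hb', mul_assoc] using this

theorem braid_of_mul_pow_four {G : Type*} [Group G] {a b : G} (ha : a * a = 1) (hb : b * b = 1)
    (h : (a * b) ^ 4 = 1) : a * b * a * b = b * a * b * a := by
  have ha' : a⁻¹ = a := inv_eq_of_mul_eq_one_left ha
  have hb' : b⁻¹ = b := inv_eq_of_mul_eq_one_left hb
  have : a * b * a * b * (a * b * a * b) = 1 := by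
    rw [← h]
    simp only [pow_succ, pow_zero, one_mul, mul_assoc]
  rw [← eq_inv_iff_mul_eq_one] at this
  simpa [mul_inv_rev, ha', hb', mul_assoc] using this

/-- The action of the generators of type `A` on the integers by adjacent transpositions. -/
def actA (j : ℕ) (x : ℤ) : ℤ := if x = j then j + 1 else if x = j + 1 then j else x

/-- The action of the generators of type `B` on the integers by signed permutations. -/
def actB : ℕ → ℤ → ℤ
  | 0, x => if x = 1 ∨ x = -1 then -x else x
  | j + 1, x => if x = j + 1 ∨ x = -(j + 2) then x + 1
      else if x = j + 2 ∨ x = -(j + 1) then x - 1 else x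

theorem actA_actA (j : ℕ) (x : ℤ) : actA j (actA j x) = x := by
  grind [actA]

theorem actA_comm {i j : ℕ} (h : i + 1 < j) (x : ℤ) :
    actA i (actA j x) = actA j (actA i x) := by
  grind [actA]

theorem actA_braid (i : ℕ) (x : ℤ) :
    actA i (actA (i + 1) (actA i x)) = actA (i + 1) (actA i (actA (i + 1) x)) := by
  grind [actA]

theorem actA_of_lt {j : ℕ} {x : ℤ} (h : j + 1 < x) : actA j x = x := by
  grind [actA]

theorem actB_actB (j : ℕ) (x : ℤ) : actB j (actB j x) = x := by
  cases j <;> grind [actB]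

theorem actB_comm {i j : ℕ} (h : i + 1 < j) (x : ℤ) :
    actB i (actB j x) = actB j (actB i x) := by
  obtain ⟨j, rfl⟩ := Nat.exists_eq_add_one_of_ne_zero (Nat.ne_of_gt (Nat.zero_lt_of_lt h))
  cases i <;> grind [actB]

theorem actB_braid (i : ℕ) (x : ℤ) :
    actB (i + 1) (actB (i + 2) (actB (i + 1) x)) =
      actB (i + 2) (actB (i + 1) (actB (i + 2) x)) := by
  grind (splits := 20) [actB]

theorem actB_braid_zero (x : ℤ) :
    actB 0 (actB 1 (actB 0 (actB 1 x))) = actB 1 (actB 0 (actB 1 (actB 0 x))) := by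
  grind [actB]

theorem actB_of_lt {j : ℕ} {x : ℤ} (h : j + 1 < x) : actB j x = x := by
  cases j <;> grind [actB]

end Relations

/-! ### Tools for verifying the coset chain, common to both types. -/

section Types

variable {n : ℕ} [NeZero n] {M : CoxeterMatrix (Fin n)} {W : Type*} [Group W]
  {cs : CoxeterSystem M W} {top : ℕ → ℕ}

/-- Multiplication by the generator `j` either moves the representative of a coset along the chain
or passes through it as a smaller generator. -/
def IsStep (cs : CoxeterSystem M W) (top : ℕ → ℕ) (i j k : ℕ) : Prop :=
  (∃ k' ≤ top i, (k' = k + 1 ∨ k = k' + 1) ∧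
    gen cs j * chainRep cs top i k = chainRep cs top i k') ∨
  ∃ j', j' + 1 < i ∧ gen cs j * chainRep cs top i k = chainRep cs top i k * gen cs j'

theorem commute_chainRep {i : ℕ} (hi : i ≤ n) {w : W} (hw : ∀ j < i, Commute (gen cs j) w)
    (k : ℕ) : Commute (chainRep cs top i k) w :=
  commute_wordProd hw (chainWord_lt hi k)

theorem commute_longest {i : ℕ} (hi : i ≤ n) {w : W} (hw : ∀ j < i, Commute (gen cs j) w) :
    Commute (longest cs top i) w :=
  commute_wordProd hw (rankWord_lt hi _)

theorem isStep_zero (ht : IsChainLength top) {i j : ℕ} (hj : j ≤ i) :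
    IsStep cs top (i + 1) j 0 := by
  rcases hj.eq_or_lt with rfl | hlt
  · refine Or.inl ⟨1, ?_, Or.inl rfl, ?_⟩
    · rcases ht.succ j with h | h <;> omega
    · rw [chainRep_succ (Nat.zero_le _)]
      simp
  · exact Or.inr ⟨j, Nat.succ_lt_succ hlt, by simp⟩

theorem isStep_one {i : ℕ} : IsStep cs top (i + 1) i 1 := by
  refine Or.inl ⟨0, Nat.zero_le _, Or.inr rfl, ?_⟩
  rw [chainRep_succ (Nat.zero_le _)]
  simp

/-- The representative is one from the previous level times the generator `i`. A generator that
slides through the former has index below i - 1, so it also passes the latter. -/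
theorem isStep_succ (ht : IsChainLength top) {i j k : ℕ} (hk : k ≤ top i)
    (hcomm : ∀ j, j + 1 < i → Commute (gen cs j) (gen cs i)) (h : IsStep cs top i j k) :
    IsStep cs top (i + 1) j (k + 1) := by
  rw [IsStep, chainRep_succ hk, ← mul_assoc]
  rcases h with ⟨k', hk', hkk, e⟩ | ⟨j', hj', e⟩
  · refine Or.inl ⟨k' + 1, ?_, by omega, ?_⟩
    · rcases ht.succ i with h | h <;> omega
    · rw [chainRep_succ hk', e]
  · refine Or.inr ⟨j', by omega, ?_⟩
    rw [e, mul_assoc, (hcomm j' hj').eq, mul_assoc]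

/-- With s_i, s_{i+1} at the end of the representative, s_{i+1} commutes past the front part and
then s_{i+1} s_i s_{i+1} = s_i s_{i+1} s_i. -/
theorem isStep_braid {i k : ℕ} (hi : i + 1 < n) (hk : k ≤ top i) (hk' : k + 1 ≤ top (i + 1))
    (hcomm : ∀ j < i, Commute (gen cs j) (gen cs (i + 1)))
    (hbraid : gen cs i * gen cs (i + 1) * gen cs i = gen cs (i + 1) * gen cs i * gen cs (i + 1)) :
    IsStep cs top (i + 2) (i + 1) (k + 2) := by
  refine Or.inr ⟨i, by omega, ?_⟩
  have hc := (commute_chainRep (top := top) (by omega) hcomm k).eq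
  rw [chainRep_succ hk', chainRep_succ hk, ← mul_assoc, ← mul_assoc, ← hc]
  simp only [mul_assoc] at hbraid ⊢
  rw [hbraid]

theorem map_one_apply {X : Type*} (ρ : W →* Function.End X) (x : X) : ρ 1 x = x := by
  rw [map_one]
  rfl

theorem map_mul_apply {X : Type*} (ρ : W →* Function.End X) (v w : W) (x : X) :
    ρ (v * w) x = ρ v (ρ w x) := by
  rw [map_mul]
  rfl

theorem lift_gen (cs : CoxeterSystem M W) {X : Type*} (f : ℕ → Function.End X)
    (hf : M.IsLiftable fun a : Fin n => f a) {i : ℕ} (hi : i < n) :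
    cs.lift ⟨_, hf⟩ (gen cs i) = f i := by
  rw [gen, cs.lift_apply_simple, val_ofNat_of_lt hi]

/-- Cosets are separated by an action of the group for which `pt` is fixed by the subgroup. -/
theorem chainRep_sep {X : Type*} (ρ : W →* Function.End X) {i k k' : ℕ} {u v : List (Fin n)}
    {pt : X} (hpt : ∀ j < i, ρ (gen cs j) pt = pt)
    (hu : ∀ a ∈ u, (a : ℕ) < i) (hv : ∀ a ∈ v, (a : ℕ) < i)
    (e : chainRep cs top (i + 1) k * cs.wordProd u = chainRep cs top (i + 1) k' * cs.wordProd v) :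
    ρ (chainRep cs top (i + 1) k) pt = ρ (chainRep cs top (i + 1) k') pt := by
  have fix : ∀ u : List (Fin n), (∀ a ∈ u, (a : ℕ) < i) → ρ (cs.wordProd u) pt = pt := by
    intro u hu
    induction u with
    | nil => exact map_one_apply ρ pt
    | cons a u ih =>
      rw [cs.wordProd_cons, map_mul_apply, simple_eq_gen,
        ih fun b hb => hu b (by simp [hb]), hpt a (hu a (by simp))]
  have h := congrFun (congrArg ρ e) pt
  rwa [map_mul_apply, map_mul_apply, fix u hu, fix v hv] at h

/-- The part of the reversal shared by both types: reversal one level down, after which the longest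
element on `i` letters commutes with the generator `i + 1`. It remains to move the top
representative to the right. -/
theorem longest_mul_chainRep_succ_succ {i k : ℕ} (hi : i + 1 < n) (hk : k ≤ top (i + 1))
    (hcomm : ∀ j < i, Commute (gen cs j) (gen cs (i + 1)))
    (ih : longest cs top (i + 1) * chainRep cs top (i + 1) k =
      chainRep cs top (i + 1) (top (i + 1) - k) * longest cs top i) :
    longest cs top (i + 2) * chainRep cs top (i + 2) (k + 1) =
      chainRep cs top (i + 2) (top (i + 2)) *
        chainRep cs top (i + 1) (top (i + 1) - k) * gen cs (i + 1) * longest cs top i := by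
  have hc := (commute_longest (top := top) (by omega) hcomm).eq
  rw [longest_succ, chainRep_succ hk]
  simp only [mul_assoc]
  rw [← hc]
  simp only [← mul_assoc]
  rw [mul_assoc _ (longest cs top (i + 1)), ih]
  simp only [mul_assoc]

/-! ### Steps and reversal in type A. -/

section TypeA

/-- The chain lengths in type `A`. -/
def topA (i : ℕ) : ℕ := i

theorem isChainLength_topA : IsChainLength topA := ⟨rfl, fun _ => Or.inl rfl⟩

variable (hcomm : ∀ {i j : ℕ}, i < n → j + 1 < i → Commute (gen cs j) (gen cs i))
  (hbraid : ∀ {i : ℕ}, i + 1 < n →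
    gen cs i * gen cs (i + 1) * gen cs i = gen cs (i + 1) * gen cs i * gen cs (i + 1))

include hcomm hbraid in
theorem isStep_topA {i j k : ℕ} (hi : i ≤ n) (hj : j < i) (hk : k ≤ topA i) :
    IsStep cs topA i j k := by
  induction i generalizing j k with
  | zero => omega
  | succ i ih =>
    rcases k with _ | k
    · exact isStep_zero isChainLength_topA (by omega)
    have hk' : k ≤ topA i := Nat.le_of_succ_le_succ hk
    rcases (Nat.le_of_lt_succ hj).eq_or_lt with rfl | hlt
    · rcases k with _ | k
      · exact isStep_one
      · obtain ⟨j, rfl⟩ := Nat.exists_eq_add_one_of_ne_zero (n := j)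
          (by rintro rfl; simp [topA] at hk')
        exact isStep_braid hi (Nat.le_of_succ_le_succ hk') hk'
          (fun l hl => hcomm hi (by omega)) (hbraid hi)
    · exact isStep_succ isChainLength_topA hk' (fun l hl => hcomm hi hl) (ih (by omega) hlt hk')

include hcomm hbraid in
-- The top representative is the Coxeter element s_0 ⋯ s_i, and conjugation by it shifts s_j to
-- s_{j+1} for j < i. This carries a chain word to the one of the same length a level higher.
theorem top_mul_chainRep_topA {i k : ℕ} (hi : i + 1 ≤ n) (hk : k ≤ i) :
    chainRep cs topA (i + 1) (i + 1) * chainRep cs topA i k =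
      chainRep cs topA (i + 1) k * chainRep cs topA (i + 1) (i + 1) := by
  induction i generalizing k with
  | zero => obtain rfl := Nat.le_zero.1 hk; simp
  | succ i ih =>
    rcases k with _ | k
    · simp
    have hk' : k ≤ i := Nat.le_of_succ_le_succ hk
    have hc := (commute_chainRep (top := topA) (i := i) (by omega)
      (fun l hl => hcomm (i := i + 1) hi (by omega)) k).eq
    have hc' := (commute_chainRep (top := topA) (i := i) (by omega)
      (fun l hl => hcomm (i := i + 1) hi (by omega)) i).eq
    have e1 : chainRep cs topA (i + 2) (i + 2) =
        chainRep cs topA (i + 1) (i + 1) * gen cs (i + 1) :=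
      chainRep_succ (top := topA) (le_refl (i + 1))
    have e2 : chainRep cs topA (i + 1) (i + 1) = chainRep cs topA i i * gen cs i :=
      chainRep_succ (top := topA) (le_refl i)
    have e3 : chainRep cs topA (i + 2) (k + 1) = chainRep cs topA (i + 1) k * gen cs (i + 1) :=
      chainRep_succ (top := topA) (show k ≤ i + 1 by omega)
    have e4 : chainRep cs topA (i + 1) (k + 1) = chainRep cs topA i k * gen cs i :=
      chainRep_succ (top := topA) hk'
    have pass : chainRep cs topA (i + 2) (i + 2) * gen cs i =
        gen cs (i + 1) * chainRep cs topA (i + 2) (i + 2) := by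
      rw [e1, e2, mul_assoc, mul_assoc, ← mul_assoc (gen cs i), hbraid hi]
      simp only [← mul_assoc]
      rw [hc']
    calc chainRep cs topA (i + 2) (i + 2) * chainRep cs topA (i + 1) (k + 1)
        = chainRep cs topA (i + 1) (i + 1) * (gen cs (i + 1) * chainRep cs topA i k) *
          gen cs i := by
          rw [e1, e4]; simp only [mul_assoc]
      _ = chainRep cs topA (i + 1) (i + 1) * chainRep cs topA i k *
          (gen cs (i + 1) * gen cs i) := by
          rw [← hc]; simp only [mul_assoc]
      _ = chainRep cs topA (i + 1) k * (chainRep cs topA (i + 2) (i + 2) * gen cs i) := by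
          rw [ih (by omega) hk', e1]; simp only [mul_assoc]
      _ = chainRep cs topA (i + 2) (k + 1) * chainRep cs topA (i + 2) (i + 2) := by
          rw [pass, e3, mul_assoc]

include hcomm hbraid in
theorem reversal_topA {i k : ℕ} (hi : i < n) (hk : k ≤ topA (i + 1)) :
    longest cs topA (i + 1) * chainRep cs topA (i + 1) k =
      chainRep cs topA (i + 1) (topA (i + 1) - k) * longest cs topA i := by
  induction i generalizing k with
  | zero =>
    have e : longest cs topA 1 = chainRep cs topA 1 1 * longest cs topA 0 := longest_succ 0
    have e0 : longest cs topA 0 = 1 := by simp [longest, chainCard]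
    have e1 : chainRep cs topA 1 1 = gen cs 0 := by
      rw [chainRep_succ (Nat.zero_le _)]; simp
    rcases k with _ | k
    · simp [e, topA]
    · obtain rfl : k = 0 := by simp [topA] at hk; omega
      simp [e, e0, e1, topA]
  | succ i ih =>
    rcases k with _ | k
    · rw [chainRep_zero_right, mul_one, Nat.sub_zero, longest_succ]
    have hk' : k ≤ topA (i + 1) := Nat.le_of_succ_le_succ hk
    rw [longest_mul_chainRep_succ_succ hi hk' (fun l hl => hcomm hi (by omega)) (ih (by omega) hk')]
    have e := top_mul_chainRep_topA (cs := cs) hcomm hbraid hi (k := i + 1 - k) (by omega)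
    have e1 : chainRep cs topA (i + 2) (i + 2) =
        chainRep cs topA (i + 1) (i + 1) * gen cs (i + 1) :=
      chainRep_succ (top := topA) (le_refl (i + 1))
    rw [longest_succ i]
    simp only [topA, Nat.add_sub_add_right] at e ⊢
    rw [e, e1]
    simp [mul_assoc]

end TypeA

/-! ### Steps and reversal in type B. -/

section TypeB

/-- The chain lengths in type `B`. -/
def topB (i : ℕ) : ℕ := 2 * i - 1

/-- Truncated subtraction gives `topB 0 = 0`, so the first increment is 1 and all later ones are 2.
-/
theorem isChainLength_topB : IsChainLength topB :=
  ⟨rfl, fun i => by simp only [topB]; omega⟩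

theorem chainRep_topB_one : chainRep cs topB 1 (topB 1) = gen cs 0 := by
  rw [topB, chainRep_succ (top := topB) (Nat.zero_le _)]
  simp

theorem chainRep_topB_succ_succ (i : ℕ) : chainRep cs topB (i + 2) (topB (i + 2)) =
    gen cs (i + 1) * (chainRep cs topB (i + 1) (topB (i + 1)) * gen cs (i + 1)) := by
  have : topB (i + 2) = topB (i + 1) + 1 + 1 := by simp only [topB]; omega
  rw [this, chainRep_succ_of_lt (Nat.lt_succ_self _)]

theorem chainRep_topB_mul_self (i : ℕ) : chainRep cs topB (i + 1) (topB (i + 1)) *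
    chainRep cs topB (i + 1) (topB (i + 1)) = 1 := by
  induction i with
  | zero => simp [chainRep_topB_one]
  | succ i ih =>
    rw [chainRep_topB_succ_succ]
    simp only [mul_assoc, gen_mul_gen_mul]
    rw [← mul_assoc (chainRep _ _ _ _), ih]
    simp

variable (hcomm : ∀ {i j : ℕ}, i < n → j + 1 < i → Commute (gen cs j) (gen cs i))
  (hbraid : ∀ {i : ℕ}, i + 2 < n → gen cs (i + 1) * gen cs (i + 2) * gen cs (i + 1) =
    gen cs (i + 2) * gen cs (i + 1) * gen cs (i + 2))
  (hbraid0 : 1 < n → gen cs 0 * gen cs 1 * gen cs 0 * gen cs 1 =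
    gen cs 1 * gen cs 0 * gen cs 1 * gen cs 0)

include hcomm hbraid hbraid0 in
-- As a signed permutation the top representative only changes the sign of the last coordinate,
-- which the smaller generators do not touch. In the group, the new case at each level is the
-- adjacent generator: the relation of length 4 at the double edge, the braid relation used twice
-- elsewhere.
theorem commute_chainRep_topB {i j : ℕ} (hi : i + 1 ≤ n) (hj : j < i) :
    Commute (gen cs j) (chainRep cs topB (i + 1) (topB (i + 1))) := by
  induction i generalizing j with
  | zero => omega
  | succ i ih =>
    rw [chainRep_topB_succ_succ]
    rcases (Nat.le_of_lt_succ hj).eq_or_lt with rfl | hlt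
    · rcases j with _ | j
      · rw [chainRep_topB_one, Commute, SemiconjBy]
        simpa only [mul_assoc] using hbraid0 hi
      · have hc := (commute_chainRep (top := topB) (i := j + 1) (by omega)
          (fun l hl => hcomm (i := j + 2) hi (by omega)) (topB (j + 1))).eq
        have hb := hbraid hi
        rw [chainRep_topB_succ_succ, Commute, SemiconjBy]
        set y := chainRep cs topB (j + 1) (topB (j + 1))
        set a := gen cs (j + 1)
        set b := gen cs (j + 2)
        calc a * (b * (a * (y * a) * b)) = a * b * a * y * a * b := by simp only [mul_assoc]
          _ = b * a * (b * y) * a * b := by rw [hb]; simp only [mul_assoc]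
          _ = b * a * y * (b * a * b) := by rw [← hc]; simp only [mul_assoc]
          _ = b * (a * (y * a) * b) * a := by rw [← hb]; simp only [mul_assoc]
    · have hc : Commute (gen cs j) (gen cs (i + 1)) := hcomm hi (by omega)
      exact hc.mul_right ((ih (by omega) hlt).mul_right hc)

include hcomm hbraid hbraid0 in
theorem isStep_topB {i j k : ℕ} (hi : i ≤ n) (hj : j < i) (hk : k ≤ topB i) :
    IsStep cs topB i j k := by
  induction i generalizing j k with
  | zero => omega
  | succ i ih =>
    rcases k with _ | k
    · exact isStep_zero isChainLength_topB (by omega)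
    rcases le_or_gt k (topB i) with hk' | hk'
    · rcases (Nat.le_of_lt_succ hj).eq_or_lt with rfl | hlt
      · rcases k with _ | k
        · exact isStep_one
        · obtain ⟨j, rfl⟩ := Nat.exists_eq_add_one_of_ne_zero (n := j)
            (by rintro rfl; simp [topB] at hk')
          -- Just below the top, the generator completes the representative to the palindromic top
          -- one; further below, the braid relation applies.
          rcases hk'.eq_or_lt with hk'' | hk''
          · have e : topB (j + 2) = k + 3 := by simp only [topB] at *; omega
            refine Or.inl ⟨k + 3, e.ge, Or.inl rfl, ?_⟩
            rw [chainRep_succ hk', ← e, hk'', chainRep_topB_succ_succ]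
          · obtain ⟨j, rfl⟩ := Nat.exists_eq_add_one_of_ne_zero (n := j)
              (by rintro rfl; simp [topB] at hk'')
            exact isStep_braid hi (by simp only [topB] at *; omega) hk'
              (fun l hl => hcomm hi (by omega)) (hbraid hi)
      · exact isStep_succ isChainLength_topB hk' (fun l hl => hcomm hi hl) (ih (by omega) hlt hk')
    · obtain ⟨i, rfl⟩ := Nat.exists_eq_add_one_of_ne_zero (n := i)
        (by rintro rfl; simp [topB] at hk hk'; omega)
      have e : k + 1 = topB (i + 2) := by simp only [topB] at *; omega
      rcases (Nat.le_of_lt_succ hj).eq_or_lt with rfl | hlt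
      · refine Or.inl ⟨k, by omega, Or.inr rfl, ?_⟩
        obtain rfl : k = topB (i + 1) + 1 := by simp only [topB] at *; omega
        rw [chainRep_succ_of_lt hk', gen_mul_gen_mul, chainRep_succ le_rfl]
      · refine Or.inr ⟨j, by omega, ?_⟩
        rw [e]
        exact (commute_chainRep_topB hcomm hbraid hbraid0 hi hlt).eq

include hcomm hbraid hbraid0 in
-- Here the top representative is an involution commuting with the smaller subgroup, so it passes
-- through the chain unchanged, unlike the shift in type A.
theorem reversal_topB {i k : ℕ} (hi : i < n) (hk : k ≤ topB (i + 1)) :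
    longest cs topB (i + 1) * chainRep cs topB (i + 1) k =
      chainRep cs topB (i + 1) (topB (i + 1) - k) * longest cs topB i := by
  induction i generalizing k with
  | zero =>
    have e : longest cs topB 1 = chainRep cs topB 1 1 * longest cs topB 0 := longest_succ 0
    have e0 : longest cs topB 0 = 1 := by simp [longest, chainCard]
    have e1 : chainRep cs topB 1 1 = gen cs 0 := chainRep_topB_one
    rcases k with _ | k
    · simp [e, topB]
    · obtain rfl : k = 0 := by simp [topB] at hk; omega
      simp [e, e0, e1, topB]
  | succ i ih =>
    rcases k with _ | k
    · rw [chainRep_zero_right, mul_one, Nat.sub_zero, longest_succ]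
    have hy : ∀ j < i + 1, Commute (gen cs j) (chainRep cs topB (i + 2) (topB (i + 2))) :=
      fun j hj => commute_chainRep_topB hcomm hbraid hbraid0 hi hj
    rcases le_or_gt k (topB (i + 1)) with hk' | hk'
    · rw [longest_mul_chainRep_succ_succ hi hk' (fun l hl => hcomm hi (by omega))
        (ih (by omega) hk')]
      have hc := (commute_chainRep (top := topB) hi.le hy (topB (i + 1) - k)).eq
      have e : topB (i + 2) - (k + 1) = topB (i + 1) - k + 1 := by simp only [topB] at *; omega
      rw [e, chainRep_succ (Nat.sub_le _ _), longest_succ i, ← hc, chainRep_topB_succ_succ]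
      simp [mul_assoc]
    · have e : k + 1 = topB (i + 2) := by simp only [topB] at *; omega
      have hc := (commute_longest (top := topB) hi.le hy).eq
      rw [e, Nat.sub_self, chainRep_zero_right, one_mul, longest_succ, mul_assoc, hc, ← mul_assoc,
        chainRep_topB_mul_self, one_mul]

end TypeB
end Types

/-! ### The coset chain for the Coxeter matrix of type A. -/

section TypeA

variable {n : ℕ}

theorem A_apply (a b : Fin n) : CoxeterMatrix.A n a b =
    if (a : ℕ) = b then 1 else if (b : ℕ) + 1 = a ∨ (a : ℕ) + 1 = b then 3 else 2 := by
  simp only [← Fin.ext_iff]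
  rfl

theorem isLiftable_actA :
    (CoxeterMatrix.A n).IsLiftable (G := Function.End ℤ) fun a : Fin n => actA a := by
  intro a b
  let f : ℕ → Function.End ℤ := actA
  have sq : ∀ j, f j * f j = 1 := fun j => funext (actA_actA j)
  have comm : ∀ {i j}, i + 1 < j → f i * f j = f j * f i := fun h => funext (actA_comm h)
  have braid : ∀ j, f j * f (j + 1) * f j = f (j + 1) * f j * f (j + 1) :=
    fun j => funext (actA_braid j)
  change (f a * f b) ^ _ = 1
  rw [A_apply]
  split_ifs with h1 h2
  · rw [h1, pow_one, sq]
  · refine mul_pow_three_of_braid (sq _) (sq _) ?_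
    rcases h2 with h2 | h2
    · rw [← h2, braid]
    · rw [← h2, braid]
  · refine mul_pow_two_of_commute (sq _) (sq _) ?_
    rcases Nat.lt_or_gt_of_ne h1 with h | h
    · exact comm (by omega)
    · exact (comm (by omega)).symm

variable [NeZero n] {W : Type*} [Group W] (cs : CoxeterSystem (CoxeterMatrix.A n) W)

theorem gen_comm_of_eq_two {M : CoxeterMatrix (Fin n)} (cs : CoxeterSystem M W) {i j : ℕ}
    (h : M (Fin.ofNat n i) (Fin.ofNat n j) = 2) : Commute (gen cs i) (gen cs j) :=
  commute_of_mul_pow_two (gen_mul_self cs i) (gen_mul_self cs j)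
    (h ▸ cs.simple_mul_simple_pow (Fin.ofNat n i) (Fin.ofNat n j))

theorem gen_braid_of_eq_three {M : CoxeterMatrix (Fin n)} (cs : CoxeterSystem M W) {i j : ℕ}
    (h : M (Fin.ofNat n i) (Fin.ofNat n j) = 3) :
    gen cs i * gen cs j * gen cs i = gen cs j * gen cs i * gen cs j :=
  braid_of_mul_pow_three (gen_mul_self cs i) (gen_mul_self cs j)
    (h ▸ cs.simple_mul_simple_pow (Fin.ofNat n i) (Fin.ofNat n j))

theorem gen_braid_of_eq_four {M : CoxeterMatrix (Fin n)} (cs : CoxeterSystem M W) {i j : ℕ}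
    (h : M (Fin.ofNat n i) (Fin.ofNat n j) = 4) :
    gen cs i * gen cs j * gen cs i * gen cs j = gen cs j * gen cs i * gen cs j * gen cs i :=
  braid_of_mul_pow_four (gen_mul_self cs i) (gen_mul_self cs j)
    (h ▸ cs.simple_mul_simple_pow (Fin.ofNat n i) (Fin.ofNat n j))

theorem isCosetChain_topA : IsCosetChain cs topA := by
  have hcomm : ∀ {i j : ℕ}, i < n → j + 1 < i → Commute (gen cs j) (gen cs i) := by
    intro i j hi hj
    apply gen_comm_of_eq_two
    rw [A_apply, val_ofNat_of_lt hi, val_ofNat_of_lt (by omega), if_neg (by omega),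
      if_neg (by omega)]
  have hbraid : ∀ {i : ℕ}, i + 1 < n →
      gen cs i * gen cs (i + 1) * gen cs i = gen cs (i + 1) * gen cs i * gen cs (i + 1) := by
    intro i hi
    apply gen_braid_of_eq_three
    rw [A_apply, val_ofNat_of_lt hi, val_ofNat_of_lt (by omega), if_neg (by omega),
      if_pos (Or.inr rfl)]
  let ρ : W →* Function.End ℤ := cs.lift ⟨_, isLiftable_actA⟩
  have hρ : ∀ {i}, i < n → ∀ x, ρ (gen cs i) x = actA i x :=
    fun hi x => congrFun (lift_gen cs actA isLiftable_actA hi) x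
  -- The representatives send the point i to different places, while the smaller subgroup fixes it;
  -- this separates the cosets.
  have hval : ∀ {i k : ℕ}, i ≤ n → k ≤ i → ρ (chainRep cs topA i k) i = (i : ℤ) - k := by
    intro i k hi hk
    induction i generalizing k with
    | zero =>
      obtain rfl := Nat.le_zero.1 hk
      rw [chainRep_zero_right, map_one_apply]
      simp
    | succ i ih =>
      rcases k with _ | k
      · rw [chainRep_zero_right, map_one_apply]
        simp
      · rw [chainRep_succ (top := topA) (Nat.le_of_succ_le_succ hk), map_mul_apply, hρ hi]
        have e : actA i ((i + 1 : ℕ) : ℤ) = i := by grind [actA]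
        rw [e, ih (by omega) (by omega)]
        push_cast
        ring
  refine ⟨isChainLength_topA, hcomm, ?_, ?_, reversal_topA hcomm hbraid⟩
  · intro i j k hi hj hk
    exact (isStep_topA hcomm hbraid hi (Nat.lt_succ_of_le hj) hk).imp_right
      fun ⟨j', hj', e⟩ => ⟨j', Nat.lt_of_succ_lt_succ hj', e⟩
  · intro i k k' u v hi hk hk' hu hv e
    have := chainRep_sep ρ (pt := ((i + 1 : ℕ) : ℤ)) (fun j hj => ?_) hu hv e
    · rw [hval hi hk, hval hi hk'] at this
      omega
    · rw [hρ (hj.trans hi), actA_of_lt (by omega)]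

end TypeA

/-! ### The coset chain for the Coxeter matrix of type B. -/

section TypeB

variable {n : ℕ}

theorem typeB_apply (a b : Fin n) : typeB n a b =
    if (a : ℕ) = b then 1 else if (a : ℕ) = 0 ∧ (b : ℕ) = 1 ∨ (b : ℕ) = 0 ∧ (a : ℕ) = 1 then 4 else
      if (b : ℕ) + 1 = a ∨ (a : ℕ) + 1 = b then 3 else 2 := by
  have ha := a.isLt
  have hb := b.isLt
  have e : typeB n a b = if a.rev = b.rev then 1
      else (if (a.rev : ℕ) = n - 1 ∧ (b.rev : ℕ) = n - 2 ∨
          (b.rev : ℕ) = n - 1 ∧ (a.rev : ℕ) = n - 2 then 4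
        else (if (b.rev : ℕ) + 1 = a.rev ∨ (a.rev : ℕ) + 1 = b.rev then 3 else 2)) := rfl
  rw [e]
  simp only [Fin.ext_iff, Fin.val_rev]
  split_ifs <;> omega

theorem isLiftable_actB :
    (typeB n).IsLiftable (G := Function.End ℤ) fun a : Fin n => actB a := by
  intro a b
  let f : ℕ → Function.End ℤ := actB
  have sq : ∀ j, f j * f j = 1 := fun j => funext (actB_actB j)
  have comm : ∀ {i j}, i + 1 < j → f i * f j = f j * f i := fun h => funext (actB_comm h)
  have braid : ∀ {j}, j ≠ 0 → f j * f (j + 1) * f j = f (j + 1) * f j * f (j + 1) := by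
    intro j hj
    obtain ⟨j, rfl⟩ := Nat.exists_eq_add_one_of_ne_zero hj
    exact funext (actB_braid j)
  have braid_zero : f 0 * f 1 * f 0 * f 1 = f 1 * f 0 * f 1 * f 0 := funext actB_braid_zero
  change (f a * f b) ^ _ = 1
  rw [typeB_apply]
  split_ifs with h1 h2 h3
  · rw [h1, pow_one, sq]
  · refine mul_pow_four_of_braid (sq _) (sq _) ?_
    rcases h2 with ⟨h, h'⟩ | ⟨h, h'⟩ <;> rw [h, h', braid_zero]
  · refine mul_pow_three_of_braid (sq _) (sq _) ?_
    rcases h3 with h3 | h3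
    · rw [← h3, braid (by omega)]
    · rw [← h3, braid (by omega)]
  · refine mul_pow_two_of_commute (sq _) (sq _) ?_
    rcases Nat.lt_or_gt_of_ne h1 with h | h
    · exact comm (by omega)
    · exact (comm (by omega)).symm

variable [NeZero n] {W : Type*} [Group W] (cs : CoxeterSystem (typeB n) W)

theorem isCosetChain_topB : IsCosetChain cs topB := by
  have hcomm : ∀ {i j : ℕ}, i < n → j + 1 < i → Commute (gen cs j) (gen cs i) := by
    intro i j hi hj
    apply gen_comm_of_eq_two
    rw [typeB_apply, val_ofNat_of_lt hi, val_ofNat_of_lt (by omega),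
      if_neg (by omega), if_neg (by omega), if_neg (by omega)]
  have hbraid : ∀ {i : ℕ}, i + 2 < n → gen cs (i + 1) * gen cs (i + 2) * gen cs (i + 1) =
      gen cs (i + 2) * gen cs (i + 1) * gen cs (i + 2) := by
    intro i hi
    apply gen_braid_of_eq_three
    rw [typeB_apply, val_ofNat_of_lt hi, val_ofNat_of_lt (by omega),
      if_neg (by omega), if_neg (by omega), if_pos (Or.inr rfl)]
  have hbraid0 : 1 < n → gen cs 0 * gen cs 1 * gen cs 0 * gen cs 1 =
      gen cs 1 * gen cs 0 * gen cs 1 * gen cs 0 := by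
    intro hn
    apply gen_braid_of_eq_four
    rw [typeB_apply, val_ofNat_of_lt hn, val_ofNat_of_lt (by omega),
      if_neg (by omega), if_pos (Or.inl ⟨rfl, rfl⟩)]
  let ρ : W →* Function.End ℤ := cs.lift ⟨_, isLiftable_actB⟩
  have hρ : ∀ {i}, i < n → ∀ x, ρ (gen cs i) x = actB i x :=
    fun hi x => congrFun (lift_gen cs actB isLiftable_actB hi) x
  -- The images of i + 1 run down through i + 1, …, 1, -1, …, -(i + 1); the case distinction skips
  -- 0.
  have hval : ∀ {i k : ℕ}, i + 1 ≤ n → k ≤ topB (i + 1) →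
      ρ (chainRep cs topB (i + 1) k) (i + 1) =
        if k < i + 1 then (i : ℤ) + 1 - k else (i : ℤ) - k := by
    intro i k hi hk
    induction i generalizing k with
    | zero =>
      rcases k with _ | k
      · rw [chainRep_zero_right, map_one_apply]
        simp
      · obtain rfl : k = 0 := by simp [topB] at hk; omega
        rw [chainRep_succ (Nat.zero_le _), chainRep_zero_right, one_mul, hρ hi]
        simp [actB]
    | succ i ih =>
      rcases k with _ | k
      · rw [chainRep_zero_right, map_one_apply]
        simp
      have e : actB (i + 1) (((i + 1 : ℕ) : ℤ) + 1) = i + 1 := by grind [actB]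
      rcases le_or_gt k (topB (i + 1)) with hk' | hk'
      · rw [chainRep_succ hk', map_mul_apply, hρ hi, e, ih (by omega) hk']
        grind
      · obtain e' : k + 1 = topB (i + 2) := by simp only [topB] at *; omega
        have e'' : k = 2 * i + 2 := by simp only [topB] at *; omega
        rw [e', chainRep_topB_succ_succ, map_mul_apply, map_mul_apply, hρ hi, hρ hi, e,
          ih (by omega) le_rfl]
        grind [actB, topB]
  refine ⟨isChainLength_topB, hcomm, ?_, ?_, reversal_topB hcomm hbraid hbraid0⟩
  · intro i j k hi hj hk
    exact (isStep_topB hcomm hbraid hbraid0 hi (Nat.lt_succ_of_le hj) hk).imp_right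
      fun ⟨j', hj', e⟩ => ⟨j', Nat.lt_of_succ_lt_succ hj', e⟩
  · intro i k k' u v hi hk hk' hu hv e
    have := chainRep_sep ρ (pt := (i + 1 : ℤ)) (fun j hj => ?_) hu hv e
    · rw [hval hi hk, hval hi hk'] at this
      split_ifs at this <;> omega
    · rw [hρ (hj.trans hi), actB_of_lt (by omega)]

end TypeB

end DeletionOrder

/-! ### The main theorem. -/

theorem theorem7p1 (n : ℕ) (M : CoxeterMatrix (Fin n))
    (hM : M = CoxeterMatrix.A n ∨ M = DeletionOrder.typeB n)
    {W : Type*} [Group W] (cs : CoxeterSystem M W) :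
    Finite W ∧ (∃! ω₀ : W, DeletionOrder.IsLongest cs ω₀) ∧
      ∀ ω₀ : W, DeletionOrder.IsLongest cs ω₀ → ∀ w : W,
        DeletionOrder.label cs w + DeletionOrder.label cs (ω₀ * w) = Nat.card W + 1 := by
  -- Generators are indexed by natural numbers through `Fin.ofNat`, which needs n ≠ 0. For n = 0 the
  -- group is trivial and its only label is 1.
  rcases Nat.eq_zero_or_pos n with rfl | hn
  · have : Subsingleton W := ⟨fun v w => by
      obtain ⟨u, rfl⟩ := cs.wordProd_surjective v
      obtain ⟨u', rfl⟩ := cs.wordProd_surjective w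
      rw [Subsingleton.elim u u']⟩
    refine ⟨inferInstance, ⟨1, fun w => (congrArg cs.length (Subsingleton.elim w 1)).le,
      fun _ _ => Subsingleton.elim _ _⟩, fun ω₀ _ w => ?_⟩
    simp [DeletionOrder.label, DeletionOrder.groupLT, DeletionOrder.wordLT, DeletionOrder.levelLT]
  · have : NeZero n := ⟨hn.ne'⟩
    obtain ⟨top, h⟩ : ∃ top, DeletionOrder.IsCosetChain cs top := by
      rcases hM with rfl | rfl
      · exact ⟨_, DeletionOrder.isCosetChain_topA cs⟩
      · exact ⟨_, DeletionOrder.isCosetChain_topB cs⟩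
    refine ⟨h.finite, ⟨_, h.isLongest_iff.2 rfl, fun _ hω => h.isLongest_iff.1 hω⟩, ?_⟩
    rintro ω₀ hω w
    rw [h.isLongest_iff.1 hω]
    exact h.label_add_label w
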